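/- Let $B$ be a real $n\times n$ matrix which is expanding (every complex eigenvalue $\lambda$ of $B$ satisfies $|\lambda|>1$), and let $\mathcal{D}\subset\mathbb{R}^n$ be a finite set with $0\in\mathcal{D}$ and $\mathrm{card}(\mathcal{D})=|\det B|=:m$. For $d\in\mathcal{D}$ put $f_d(x)=B^{-1}(x+d)$, and let $K=K(B,\mathcal{D})$ be the unique non-empty compact set with $K=\bigcup_{d\in\mathcal{D}}f_d(K)$. For $s\ge 1$ let $$\mathcal{D}_s=\Big\{\sum_{j=0}^{s-1}B^j\ell_j:\ \ell_0,\dots,\ell_{s-1}\in\mathcal{D}\Big\},\qquad \mathcal{D}_\infty=\bigcup_{s\ge 1}\mathcal{D}_s,$$ and let $$\mu=\lim_{s\to\infty}\ \sum_{\ell_0,\dots,\ell_{s-1}\in\mathcal{D}}\delta_{\ell_0+B\ell_1+\cdots+B^{s-1}\ell_{s-1}},$$ where $\delta_x$ is the Dirac measure at $x$ (the measures on the right increase with $s$, since $0\in\mathcal{D}$, and the limit is taken on every Borel set). For a positive Borel measure $\nu$ on $\mathbb{R}^n$ let $$D^+(\nu)=\limsup_{N\to\infty}\ \sup_{z\in\mathbb{R}^n}\frac{\nu(I_N(z))}{N^n}\in[0,\infty],\qquad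 I_N(z)=\{y\in\mathbb{R}^n:\ |y_i-z_i|\le N/2,\ i=1,\dots,n\}.$$ Then the following conditions are equivalent. (i) The iterated function system $\{f_d\}_{d\in\mathcal{D}}$ satisfies the open set condition: there is a non-empty bounded open set $V\subset\mathbb{R}^n$ with $\bigcup_{d\in\mathcal{D}}f_d(V)\subset V$ and $f_d(V)\cap f_{d'}(V)=\emptyset$ for all $d\ne d'$ in $\mathcal{D}$. (ii) For every $k\ge 1$ the $m^k$ expansions $\sum_{j=0}^{k-1}B^j\ell_j$, $(\ell_0,\dots,\ell_{k-1})\in\mathcal{D}^k$, are pairwise distinct, and $\mathcal{D}_\infty$ is uniformly discrete: there is $\delta>0$ with $\|x-y\|>\delta$ for all $x\ne y$ in $\mathcal{D}_\infty$. (iii) $|K(B,\mathcal{D})|>0$, where $|\cdot|$ denotes Lebesgue measure. (iv) $0<D^+(\mu)<\infty$. (v) $\mu$ is translation-bounded: for every compact set $C\subset\mathbb{R}^n$ there is a finite constant $c_C\ge 0$ with $\mu(C+z)\le c_C$ for all $z\in\mathbb{R}^n$. -/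

import Mathlib

open MeasureTheory Filter Topology

namespace SelfAffine

/-- `ℝⁿ` with the Euclidean norm. -/
abbrev E (n : ℕ) : Type := EuclideanSpace ℝ (Fin n)

/-- The action `x ↦ B x` of a real `n × n` matrix on `ℝⁿ`. -/
noncomputable def act {n : ℕ} (B : Matrix (Fin n) (Fin n) ℝ) : E n →L[ℝ] E n :=
  Matrix.toEuclideanCLM (n := Fin n) (𝕜 := ℝ) B

/-- `B` is expanding: every (complex) eigenvalue of `B` has modulus greater than one. -/
def IsExpanding {n : ℕ} (B : Matrix (Fin n) (Fin n) ℝ) : Prop :=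
  ∀ z : ℂ, Module.End.HasEigenvalue (Matrix.toLin' (B.map (fun r : ℝ => (r : ℂ)))) z → 1 < ‖z‖

/-- The maps `f_d(x) = B⁻¹ (x + d)` of the iterated function system. -/
noncomputable def ifsMap {n : ℕ} (B : Matrix (Fin n) (Fin n) ℝ) (d x : E n) : E n :=
  act B⁻¹ (x + d)

/-- `K` is a non-empty compact set with `K = ⋃_{d ∈ D} f_d(K)`. -/
def IsSelfAffineSet {n : ℕ} (B : Matrix (Fin n) (Fin n) ℝ) (D : Finset (E n))
    (K : Set (E n)) : Prop :=
  K.Nonempty ∧ IsCompact K ∧ K = ⋃ d ∈ D, ifsMap B d '' K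

/-- The self-affine set `K(B, D)`: the non-empty compact set `K` with `K = ⋃_{d ∈ D} f_d(K)`.
It exists and is unique when `B` is expanding and `D` is non-empty, see
`isSelfAffineSet_selfAffineSet` and `IsSelfAffineSet.eq_selfAffineSet`. -/
noncomputable def selfAffineSet {n : ℕ} (B : Matrix (Fin n) (Fin n) ℝ) (D : Finset (E n)) :
    Set (E n) :=
  Classical.epsilon (IsSelfAffineSet B D)

/-- The open set condition for the iterated function system `{f_d : d ∈ D}`. -/
def OpenSetCondition {n : ℕ} (B : Matrix (Fin n) (Fin n) ℝ) (D : Finset (E n)) : Prop :=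
  ∃ V : Set (E n), IsOpen V ∧ V.Nonempty ∧ Bornology.IsBounded V ∧
    (⋃ d ∈ D, ifsMap B d '' V) ⊆ V ∧
    ∀ d ∈ D, ∀ d' ∈ D, d ≠ d' → Disjoint (ifsMap B d '' V) (ifsMap B d' '' V)

/-- The expansion `ℓ₀ + B ℓ₁ + ⋯ + B^{s-1} ℓ_{s-1}` of a word of `s` digits. -/
noncomputable def expansion {n : ℕ} (B : Matrix (Fin n) (Fin n) ℝ) (D : Finset (E n)) {s : ℕ}
    (l : Fin s → D) : E n :=
  ∑ j : Fin s, act (B ^ (j : ℕ)) (l j : E n)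

/-- The set `D_s` of all expansions of length `s`. -/
def digitSet {n : ℕ} (B : Matrix (Fin n) (Fin n) ℝ) (D : Finset (E n)) (s : ℕ) : Set (E n) :=
  Set.range (fun l : Fin s → D => expansion B D l)

/-- The set `D_∞ = ⋃_{s ≥ 1} D_s`. -/
def digitSetInfty {n : ℕ} (B : Matrix (Fin n) (Fin n) ℝ) (D : Finset (E n)) : Set (E n) :=
  ⋃ s : ℕ, ⋃ _ : 1 ≤ s, digitSet B D s

/-- The `card(D)^k` expansions in `D_k` are pairwise distinct. -/
def DistinctExpansions {n : ℕ} (B : Matrix (Fin n) (Fin n) ℝ) (D : Finset (E n)) (k : ℕ) : Prop :=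
  Function.Injective (fun l : Fin k → D => expansion B D l)

/-- `S` is uniformly discrete: there is `δ > 0` with `‖x - y‖ > δ` for distinct points of `S`. -/
def UniformlyDiscrete {n : ℕ} (S : Set (E n)) : Prop :=
  ∃ δ : ℝ, 0 < δ ∧ ∀ x ∈ S, ∀ y ∈ S, x ≠ y → δ < ‖x - y‖

/-- The measure `∑_{ℓ₀, …, ℓ_{s-1} ∈ D} δ_{ℓ₀ + B ℓ₁ + ⋯ + B^{s-1} ℓ_{s-1}}`; a point is counted
as many times as it has expansions. -/
noncomputable def partialMeasure {n : ℕ} (B : Matrix (Fin n) (Fin n) ℝ) (D : Finset (E n))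
    (s : ℕ) : Measure (E n) :=
  ∑ l : Fin s → D, Measure.dirac (expansion B D l)

/-- The measure `μ = lim_{s → ∞} ∑_{ℓ₀, …, ℓ_{s-1} ∈ D} δ_{ℓ₀ + B ℓ₁ + ⋯ + B^{s-1} ℓ_{s-1}}`.
When `0 ∈ D` the measures on the right increase with `s`, so that the limit is their supremum;
`tendsto_partialMeasure` says that it is indeed the limit on every measurable set. -/
noncomputable def digitMeasure {n : ℕ} (B : Matrix (Fin n) (Fin n) ℝ) (D : Finset (E n)) :
    Measure (E n) :=
  ⨆ s : ℕ, partialMeasure B D s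

/-- The closed cube `I_N(z)` with centre `z` and side length `N`. -/
def cube {n : ℕ} (N : ℝ) (z : E n) : Set (E n) :=
  {y | ∀ i, |y i - z i| ≤ N / 2}

/-- The upper Beurling density `D⁺(ν) = limsup_{N → ∞} sup_z ν(I_N(z)) / Nⁿ`. -/
noncomputable def upperBeurlingDensity {n : ℕ} (ν : Measure (E n)) : ENNReal :=
  limsup (fun N : ℝ => ⨆ z : E n, ν (cube N z) / ENNReal.ofReal (N ^ n)) atTop

/-- `ν` is translation-bounded: for every compact `K` the numbers `ν(K + z)` are bounded by a
finite constant. -/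
def TranslationBounded {n : ℕ} (ν : Measure (E n)) : Prop :=
  ∀ K : Set (E n), IsCompact K → ∃ C : NNReal, ∀ z : E n, ν ((fun x => x + z) '' K) ≤ C

/-! Well-definedness of `selfAffineSet`. -/

theorem IsExpanding.isUnit_det {n : ℕ} {B : Matrix (Fin n) (Fin n) ℝ} (hB : IsExpanding B) :
    IsUnit B.det := by
  rw [isUnit_iff_ne_zero]
  intro h0
  have h1 : (B.map (fun r : ℝ => (r : ℂ))).det = 0 := by
    have := (RingHom.map_det Complex.ofRealHom B)
    rw [h0, map_zero] at this
    exact this.symm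
  obtain ⟨v, hv, hv0⟩ := Matrix.exists_mulVec_eq_zero_iff.mpr h1
  have := hB 0 (Module.End.hasEigenvalue_of_hasEigenvector (x := v)
    ⟨by simp [hv0], hv⟩)
  simp at this
  linarith

theorem exists_bound_of_finiteDimensional {V W : Type*} [NormedAddCommGroup V] [NormedSpace ℝ V]
    [FiniteDimensional ℝ V] [NormedAddCommGroup W] [NormedSpace ℝ W] (f : V →ₗ[ℝ] W) :
    ∃ C : ℝ, ∀ v, ‖f v‖ ≤ C * ‖v‖ :=
  ⟨‖LinearMap.toContinuousLinearMap f‖, (LinearMap.toContinuousLinearMap f).le_opNorm⟩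

section
attribute [local instance] Matrix.linftyOpNormedRing Matrix.linftyOpNormedAlgebra

theorem IsExpanding.summable_norm_inv_pow {n : ℕ} {B : Matrix (Fin n) (Fin n) ℝ}
    (hB : IsExpanding B) : Summable (fun j : ℕ => ‖act B⁻¹ ^ j‖) := by
  rcases Nat.eq_zero_or_pos n with hn | hn
  · subst hn
    have : ∀ j : ℕ, ‖act B⁻¹ ^ j‖ = 0 := fun j => by
      rw [norm_eq_zero]; exact Subsingleton.elim _ _
    simp only [this]
    exact summable_zero
  have : Nonempty (Fin n) := ⟨⟨0, hn⟩⟩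
  set φ : Matrix (Fin n) (Fin n) ℝ →+* Matrix (Fin n) (Fin n) ℂ :=
    Complex.ofRealHom.mapMatrix with hφ
  have hBu : IsUnit B := (Matrix.isUnit_iff_isUnit_det B).2 hB.isUnit_det
  let u : (Matrix (Fin n) (Fin n) ℂ)ˣ :=
    ⟨φ B, φ B⁻¹, by rw [← map_mul, Matrix.mul_nonsing_inv _ hB.isUnit_det, map_one],
      by rw [← map_mul, Matrix.nonsing_inv_mul _ hB.isUnit_det, map_one]⟩
  have hspec : ∀ z ∈ spectrum ℂ (φ B⁻¹), ‖z‖₊ < 1 := by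
    intro z hz
    have hz0 : z ≠ 0 := by
      rintro rfl
      exact spectrum.zero_notMem ℂ (a := φ B⁻¹) u⁻¹.isUnit hz
    have h2 : ((Units.mk0 z hz0)⁻¹ : ℂˣ).val ∈ spectrum ℂ (φ B) := by
      have := (spectrum.inv_mem_iff (R := ℂ) (r := Units.mk0 z hz0) (a := u⁻¹)).1 hz
      rwa [inv_inv] at this
    have h3 : 1 < ‖z⁻¹‖ := by
      refine hB _ ?_
      rw [Module.End.hasEigenvalue_iff_mem_spectrum, Matrix.spectrum_toLin']
      rw [Units.val_inv_eq_inv_val, Units.val_mk0] at h2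
      exact h2
    rw [norm_inv] at h3
    have h4 : 0 < ‖z‖ := norm_pos_iff.2 hz0
    rw [← NNReal.coe_lt_coe, coe_nnnorm, NNReal.coe_one]
    exact (one_lt_inv₀ h4).1 h3
  have : CompleteSpace (Matrix (Fin n) (Fin n) ℂ) := FiniteDimensional.complete ℂ _
  have hr := spectrum.spectralRadius_lt_of_forall_lt (φ B⁻¹) hspec
  obtain ⟨r, hr1, hr2⟩ := exists_between hr
  have hg := (spectrum.pow_nnnorm_pow_one_div_tendsto_nhds_spectralRadius (φ B⁻¹)).eventually
    (gt_mem_nhds hr1)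
  lift r to NNReal using ne_top_of_lt hr2
  have hr2' : r < 1 := by exact_mod_cast hr2
  have hφn : ∀ M : Matrix (Fin n) (Fin n) ℝ, ‖φ M‖ = ‖M‖ := by
    intro M
    rw [Matrix.linfty_opNorm_def, Matrix.linfty_opNorm_def]
    simp [hφ]
  have hsum : Summable (fun j : ℕ => ‖(B⁻¹) ^ j‖) := by
    refine summable_of_isBigO_nat (g := fun j : ℕ => (r : ℝ) ^ j)
      (summable_geometric_of_lt_one r.2 hr2') ?_
    refine Asymptotics.IsBigO.of_bound 1 ?_
    filter_upwards [hg, eventually_gt_atTop 0] with k hk hk0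
    have hk0' : (0 : ℝ) < k := by exact_mod_cast hk0
    have h5 : (‖φ B⁻¹ ^ k‖₊ : ENNReal) ≤ (r : ENNReal) ^ k := by
      have := ENNReal.rpow_le_rpow hk.le hk0'.le
      rwa [← ENNReal.rpow_mul, one_div, inv_mul_cancel₀ hk0'.ne', ENNReal.rpow_one,
        ENNReal.rpow_natCast] at this
    have h6 : ‖φ B⁻¹ ^ k‖ ≤ (r : ℝ) ^ k := by exact_mod_cast h5
    rw [← map_pow, hφn] at h6
    rw [one_mul, norm_norm, Real.norm_of_nonneg (by positivity)]
    exact h6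
  obtain ⟨C, hC⟩ := exists_bound_of_finiteDimensional
    ((Matrix.toEuclideanCLM (n := Fin n) (𝕜 := ℝ)).toAlgEquiv.toLinearMap)
  refine Summable.of_nonneg_of_le (fun _ => norm_nonneg _) (fun j => ?_) (hsum.mul_left C)
  refine le_trans (le_of_eq ?_) (hC (B⁻¹ ^ j))
  rw [act, ← map_pow]
  rfl

end

/-- The map sending an infinite word `ℓ` of digits to `∑_{j ≥ 0} B^{-(j+1)} ℓ_j`. -/
noncomputable def coding {n : ℕ} (B : Matrix (Fin n) (Fin n) ℝ) (D : Finset (E n))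
    (l : ℕ → D) : E n :=
  ∑' j : ℕ, (act B⁻¹ ^ (j + 1)) (l j : E n)

theorem IsExpanding.norm_term_le {n : ℕ} {B : Matrix (Fin n) (Fin n) ℝ} (D : Finset (E n)) :
    ∃ u : ℝ, ∀ (l : ℕ → D) (j : ℕ),
      ‖(act B⁻¹ ^ (j + 1)) (l j : E n)‖ ≤ ‖act B⁻¹ ^ (j + 1)‖ * u := by
  refine ⟨∑ d ∈ D, ‖d‖, fun l j => (ContinuousLinearMap.le_opNorm _ _).trans ?_⟩
  gcongr
  exact Finset.single_le_sum (f := fun d : E n => ‖d‖) (fun _ _ => norm_nonneg _) (l j).2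

theorem IsExpanding.summable_coding {n : ℕ} {B : Matrix (Fin n) (Fin n) ℝ}
    (hB : IsExpanding B) (D : Finset (E n)) (l : ℕ → D) :
    Summable (fun j : ℕ => (act B⁻¹ ^ (j + 1)) (l j : E n)) := by
  obtain ⟨u, hu⟩ := IsExpanding.norm_term_le (B := B) D
  exact Summable.of_norm_bounded
    (((summable_nat_add_iff 1).2 hB.summable_norm_inv_pow).mul_right u) (hu l)

theorem IsExpanding.coding_cons {n : ℕ} {B : Matrix (Fin n) (Fin n) ℝ}
    (hB : IsExpanding B) (D : Finset (E n)) (l : ℕ → D) :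
    coding B D l = ifsMap B (l 0) (coding B D (fun j => l (j + 1))) := by
  have h := hB.summable_coding D l
  rw [coding, h.tsum_eq_zero_add, ifsMap, map_add, coding,
    (act B⁻¹).map_tsum (hB.summable_coding D _), add_comm]
  congr 1
  · refine tsum_congr fun j => ?_
    rw [pow_succ' (act B⁻¹) (j + 1)]
    rfl

theorem IsExpanding.isSelfAffineSet_range {n : ℕ} {B : Matrix (Fin n) (Fin n) ℝ}
    (hB : IsExpanding B) {D : Finset (E n)} (hD : D.Nonempty) :
    IsSelfAffineSet B D (Set.range (coding B D)) := by
  have : Nonempty D := hD.to_subtype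
  refine ⟨Set.range_nonempty _, isCompact_range ?_, ?_⟩
  · obtain ⟨u, hu⟩ := IsExpanding.norm_term_le (B := B) D
    refine continuous_tsum (fun j => ?_)
      (((summable_nat_add_iff 1).2 hB.summable_norm_inv_pow).mul_right u) (fun j l => hu l j)
    exact (ContinuousLinearMap.continuous _).comp
      (continuous_subtype_val.comp (continuous_apply j))
  · ext x
    simp only [Set.mem_iUnion, Set.mem_image, Set.mem_range, exists_prop]
    constructor
    · rintro ⟨l, rfl⟩
      exact ⟨l 0, (l 0).2, _, ⟨_, rfl⟩, (hB.coding_cons D l).symm⟩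
    · rintro ⟨d, hd, _, ⟨l, rfl⟩, rfl⟩
      let l' : ℕ → D := fun j => Nat.casesOn j ⟨d, hd⟩ l
      have h := hB.coding_cons D l'
      exact ⟨l', h⟩

theorem IsExpanding.tendsto_pow_apply {n : ℕ} {B : Matrix (Fin n) (Fin n) ℝ}
    (hB : IsExpanding B) {K : Set (E n)} (hK : IsCompact K) {y : ℕ → E n} (hy : ∀ k, y k ∈ K) :
    Tendsto (fun k => (act B⁻¹ ^ k) (y k)) atTop (𝓝 0) := by
  obtain ⟨C, hC⟩ := hK.isBounded.exists_norm_le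
  have h := hB.summable_norm_inv_pow.tendsto_atTop_zero.mul_const C
  rw [zero_mul] at h
  refine squeeze_zero_norm (fun k => ?_) h
  refine (ContinuousLinearMap.le_opNorm _ _).trans ?_
  gcongr
  exact hC _ (hy k)

theorem IsSelfAffineSet.eq_range {n : ℕ} {B : Matrix (Fin n) (Fin n) ℝ}
    (hB : IsExpanding B) {D : Finset (E n)} {K : Set (E n)}
    (hK : IsSelfAffineSet B D K) : K = Set.range (coding B D) := by
  obtain ⟨hne, hc, heq⟩ := hK
  have hmem : ∀ x, x ∈ K ↔ ∃ d ∈ D, ∃ y ∈ K, ifsMap B d y = x := fun x => by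
    conv_lhs => rw [heq]
    simp only [Set.mem_iUnion, Set.mem_image, exists_prop]
  have key : ∀ (l : ℕ → D) (y : ℕ → E n), (∀ k, y k ∈ K) →
      ∀ x, (∀ k, x k = (∑ j ∈ Finset.range k, (act B⁻¹ ^ (j + 1)) (l j : E n))
        + (act B⁻¹ ^ k) (y k)) → Tendsto x atTop (𝓝 (coding B D l)) := by
    intro l y hy x hx
    have h1 := (hB.summable_coding D l).hasSum.tendsto_sum_nat
    have h2 := h1.add (hB.tendsto_pow_apply hc hy)
    rw [add_zero] at h2
    exact h2.congr fun k => (hx k).symm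
  have step : ∀ (k : ℕ) (d y : E n), (act B⁻¹ ^ k) (ifsMap B d y)
      = (act B⁻¹ ^ (k + 1)) d + (act B⁻¹ ^ (k + 1)) y := by
    intro k d y
    rw [ifsMap, add_comm y d, ← map_add, pow_succ]
    rfl
  apply Set.Subset.antisymm
  · intro x hx
    have hstep : ∀ z : K, ∃ p : D × K, ifsMap B (p.1 : E n) (p.2 : E n) = z := fun z => by
      obtain ⟨d, hd, y, hy, h⟩ := (hmem z).1 z.2
      exact ⟨(⟨d, hd⟩, ⟨y, hy⟩), h⟩
    choose g hg using hstep
    let y : ℕ → K := fun k => Nat.rec ⟨x, hx⟩ (fun _ z => (g z).2) k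
    let l : ℕ → D := fun k => (g (y k)).1
    refine ⟨l, ?_⟩
    have hinv : ∀ k, x = (∑ j ∈ Finset.range k, (act B⁻¹ ^ (j + 1)) (l j : E n))
        + (act B⁻¹ ^ k) ((y k).1) := by
      intro k
      induction k with
      | zero => simp [y]
      | succ k ih =>
        rw [Finset.sum_range_succ, add_assoc]
        rw [show (y (k + 1)).1 = (g (y k)).2 from rfl, ← step, hg]
        exact ih
    exact (tendsto_nhds_unique (key l (fun k => ((y k).1)) (fun k => (y k).2) (fun _ => x) hinv)
      tendsto_const_nhds)
  · rintro _ ⟨l, rfl⟩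
    obtain ⟨y, hy⟩ := hne
    refine hc.isClosed.mem_of_tendsto (key l (fun _ => y) (fun _ => hy) _ (fun k => rfl))
      (Eventually.of_forall fun k => ?_)
    have : ∀ (k : ℕ) (y : E n), y ∈ K →
        (∑ j ∈ Finset.range k, (act B⁻¹ ^ (j + 1)) (l j : E n)) + (act B⁻¹ ^ k) y ∈ K := by
      intro k
      induction k with
      | zero => intro y hy; simpa using hy
      | succ k ih =>
        intro y hy
        rw [Finset.sum_range_succ, add_assoc, ← step]
        exact ih _ ((hmem _).2 ⟨l k, (l k).2, y, hy, rfl⟩)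
    exact this k y hy

theorem isSelfAffineSet_selfAffineSet {n : ℕ} {B : Matrix (Fin n) (Fin n) ℝ}
    (hB : IsExpanding B) {D : Finset (E n)} (hD : D.Nonempty) :
    IsSelfAffineSet B D (selfAffineSet B D) :=
  Classical.epsilon_spec ⟨_, hB.isSelfAffineSet_range hD⟩

theorem IsSelfAffineSet.eq_selfAffineSet {n : ℕ} {B : Matrix (Fin n) (Fin n) ℝ}
    (hB : IsExpanding B) {D : Finset (E n)} (hD : D.Nonempty) {K : Set (E n)}
    (hK : IsSelfAffineSet B D K) : K = selfAffineSet B D :=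
  (hK.eq_range hB).trans ((isSelfAffineSet_selfAffineSet hB hD).eq_range hB).symm

/-! `digitMeasure` is the limit of the measures `partialMeasure`. -/

theorem monotone_partialMeasure {n : ℕ} (B : Matrix (Fin n) (Fin n) ℝ) {D : Finset (E n)}
    (h0 : (0 : E n) ∈ D) : Monotone (partialMeasure B D) := by
  refine monotone_nat_of_le_succ fun s => ?_
  refine Measure.le_iff.2 fun A _ => ?_
  simp only [partialMeasure, Measure.coe_finsetSum, Finset.sum_apply]
  let e : (Fin s → D) ↪ (Fin (s + 1) → D) :=
    ⟨fun l => Fin.snoc (α := fun _ => D) l ⟨0, h0⟩, fun l l' h => by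
      have := congrArg (Fin.init (α := fun _ => D)) h
      simpa using this⟩
  have he : ∀ l, expansion B D (e l) = expansion B D l := fun l => by
    change expansion B D (Fin.snoc (α := fun _ => D) l ⟨0, h0⟩) = _
    simp [expansion, Fin.sum_univ_castSucc]
  calc ∑ l : Fin s → D, (Measure.dirac (expansion B D l)) A
      = ∑ l ∈ Finset.univ.map e, (Measure.dirac (expansion B D l)) A := by
        rw [Finset.sum_map]
        exact Finset.sum_congr rfl fun l _ => by rw [he]
    _ ≤ ∑ l : Fin (s + 1) → D, (Measure.dirac (expansion B D l)) A :=
        Finset.sum_le_sum_of_subset (Finset.subset_univ _)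

theorem digitMeasure_apply {n : ℕ} (B : Matrix (Fin n) (Fin n) ℝ) {D : Finset (E n)}
    (h0 : (0 : E n) ∈ D) {A : Set (E n)} (hA : MeasurableSet A) :
    digitMeasure B D A = ⨆ s, partialMeasure B D s A := by
  have hmono := monotone_partialMeasure B h0
  let ν : Measure (E n) := Measure.ofMeasurable (fun A _ => ⨆ s, partialMeasure B D s A)
    (by simp) (by
      intro f hf hd
      simp_rw [measure_iUnion hd hf, ENNReal.tsum_eq_iSup_sum]
      rw [iSup_comm]
      refine iSup_congr fun t => ?_
      exact (ENNReal.finsetSum_iSup_of_monotone fun i s s' h => hmono h (f i)).symm)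
  have hν : ∀ A, MeasurableSet A → ν A = ⨆ s, partialMeasure B D s A := fun A hA =>
    Measure.ofMeasurable_apply A hA
  refine le_antisymm ?_ (iSup_le fun s => le_iSup (partialMeasure B D) s A)
  rw [← hν A hA]
  have : digitMeasure B D ≤ ν := iSup_le fun s => Measure.le_iff.2 fun A hA => by
    rw [hν A hA]
    exact le_iSup (fun s => partialMeasure B D s A) s
  exact this A

theorem tendsto_partialMeasure {n : ℕ} (B : Matrix (Fin n) (Fin n) ℝ) {D : Finset (E n)}
    (h0 : (0 : E n) ∈ D) {A : Set (E n)} (hA : MeasurableSet A) :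
    Tendsto (fun s => partialMeasure B D s A) atTop (𝓝 (digitMeasure B D A)) := by
  rw [digitMeasure_apply B h0 hA]
  exact tendsto_atTop_iSup fun s s' h => monotone_partialMeasure B h0 h A

end SelfAffine

namespace SelfAffine

/-! The hub is separation: some δ > 0 bounds from below the distance between expansions of distinct
words of equal length, for all lengths at once. Padding with the digit 0 shows that (ii) says
exactly this.

The open set condition makes the sets V + (expansion) disjoint, hence separation. Since B^k K is the
union of the m^k translates K + (expansion) and |det B^k| = m^k, separation is equivalent to |K| >
0. In one direction, B^{-k} carries m^k disjoint balls about the expansions into shrinking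
neighbourhoods of K without loss of total volume. In the other, the translates must overlap in null
sets, whereas nearby translates of a set of positive measure do not.

Separation bounds the number of words in translates of a compact set. If it fails, concatenating
close pairs of words packs 2^M words into one unit ball. Thus it is equivalent to
translation-boundedness, which in turn amounts to D⁺(μ) < ∞; D⁺(μ) > 0 is automatic, because the m^k
expansions lie in a set of volume a constant times m^k.

It remains to return from |K| > 0 to the open set condition, with V the interior of K. The
difficulty is that this interior is non-empty (`IsExpanding.interior_nonempty`). For large k the
boundary layer of B^k K is negligible, so B^k K is ε-dense in some unit ball; but only boundedly
many translates of K meet that ball, and boundedly many nowhere dense translates leave a hole of a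
uniform size. -/

/-! ### Powers of B and expansions of words -/

theorem act_mul_apply {n : ℕ} (M N : Matrix (Fin n) (Fin n) ℝ) (x : E n) :
    act (M * N) x = act M (act N x) := by
  simp [act, map_mul]

theorem act_one_apply {n : ℕ} (x : E n) : act (1 : Matrix (Fin n) (Fin n) ℝ) x = x := by
  simp [act]

theorem act_pow {n : ℕ} (M : Matrix (Fin n) (Fin n) ℝ) (k : ℕ) : act (M ^ k) = act M ^ k := by
  simp [act]

theorem IsExpanding.act_pow_inv_pow {n : ℕ} {B : Matrix (Fin n) (Fin n) ℝ} (hB : IsExpanding B)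
    (k : ℕ) (x : E n) : act (B ^ k) (act (B⁻¹ ^ k) x) = x := by
  rw [← act_mul_apply, Matrix.inv_pow', Matrix.mul_nonsing_inv, act_one_apply]
  rw [Matrix.det_pow]
  exact hB.isUnit_det.pow k

theorem IsExpanding.act_inv_pow_pow {n : ℕ} {B : Matrix (Fin n) (Fin n) ℝ} (hB : IsExpanding B)
    (k : ℕ) (x : E n) : act (B⁻¹ ^ k) (act (B ^ k) x) = x := by
  rw [← act_mul_apply, Matrix.inv_pow', Matrix.nonsing_inv_mul, act_one_apply]
  rw [Matrix.det_pow]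
  exact hB.isUnit_det.pow k

theorem IsExpanding.act_inv {n : ℕ} {B : Matrix (Fin n) (Fin n) ℝ} (hB : IsExpanding B)
    (x : E n) : act B (act B⁻¹ x) = x := by
  simpa using hB.act_pow_inv_pow 1 x

theorem IsExpanding.inv_act {n : ℕ} {B : Matrix (Fin n) (Fin n) ℝ} (hB : IsExpanding B)
    (x : E n) : act B⁻¹ (act B x) = x := by
  simpa using hB.act_inv_pow_pow 1 x

theorem IsExpanding.tendsto_norm_inv_pow {n : ℕ} {B : Matrix (Fin n) (Fin n) ℝ}
    (hB : IsExpanding B) : Tendsto (fun k : ℕ => ‖act (B⁻¹ ^ k)‖) atTop (𝓝 0) := by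
  simpa only [act_pow] using hB.summable_norm_inv_pow.tendsto_atTop_zero

theorem volume_act_image {n : ℕ} (M : Matrix (Fin n) (Fin n) ℝ) (S : Set (E n)) :
    volume (act M '' S) = ENNReal.ofReal |M.det| * volume S := by
  have h : LinearMap.det (act M : E n →ₗ[ℝ] E n) = M.det := by
    have : (act M : E n →ₗ[ℝ] E n) = Matrix.toLpLin 2 2 M := rfl
    rw [this, Matrix.toLpLin_eq_toLin, LinearMap.det_toLin]
  rw [← h, ← Measure.addHaar_image_continuousLinearMap]

theorem volume_act_pow_image {n : ℕ} {B : Matrix (Fin n) (Fin n) ℝ} {D : Finset (E n)}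
    (hcard : (D.card : ℝ) = |B.det|) (k : ℕ) (S : Set (E n)) :
    volume (act (B ^ k) '' S) = (D.card : ENNReal) ^ k * volume S := by
  rw [volume_act_image, Matrix.det_pow, abs_pow, ← hcard, ENNReal.ofReal_pow (by positivity),
    ENNReal.ofReal_natCast]

theorem expansion_snoc {n : ℕ} (B : Matrix (Fin n) (Fin n) ℝ) (D : Finset (E n)) {s : ℕ}
    (l : Fin s → D) (d : D) :
    expansion B D (Fin.snoc (α := fun _ => D) l d) = expansion B D l + act (B ^ s) (d : E n) := by
  simp [expansion, Fin.sum_univ_castSucc]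

theorem expansion_cons {n : ℕ} (B : Matrix (Fin n) (Fin n) ℝ) (D : Finset (E n)) {s : ℕ}
    (d : D) (l : Fin s → D) :
    expansion B D (Fin.cons (α := fun _ => D) d l) = d + act B (expansion B D l) := by
  simp [expansion, Fin.sum_univ_succ, act_one_apply, pow_succ', act_mul_apply]

theorem expansion_append {n : ℕ} (B : Matrix (Fin n) (Fin n) ℝ) (D : Finset (E n)) {s t : ℕ}
    (l : Fin s → D) (l' : Fin t → D) :
    expansion B D (Fin.append l l') = expansion B D l + act (B ^ s) (expansion B D l') := by
  simp [expansion, Fin.sum_univ_add, pow_add, act_mul_apply]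

theorem expansion_const_zero {n : ℕ} (B : Matrix (Fin n) (Fin n) ℝ) {D : Finset (E n)}
    (h0 : (0 : E n) ∈ D) (s : ℕ) : expansion B D (fun _ : Fin s => (⟨0, h0⟩ : D)) = 0 := by
  simp [expansion]

theorem expansion_cast {n : ℕ} (B : Matrix (Fin n) (Fin n) ℝ) (D : Finset (E n)) {s t : ℕ}
    (h : s = t) (l : Fin t → D) :
    expansion B D (fun i : Fin s => l (Fin.cast h i)) = expansion B D l := by
  subst h
  rfl

/-! ### Separation, and the open set condition -/

/-- Expansions of distinct words of the same length are at distance more than `δ`. -/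
def SeparatedExpansions {n : ℕ} (B : Matrix (Fin n) (Fin n) ℝ) (D : Finset (E n)) (δ : ℝ) : Prop :=
  ∀ (k : ℕ) (l l' : Fin k → D), l ≠ l' → δ < ‖expansion B D l - expansion B D l'‖

theorem distinctExpansions_and_uniformlyDiscrete_iff {n : ℕ} (B : Matrix (Fin n) (Fin n) ℝ)
    {D : Finset (E n)} (h0 : (0 : E n) ∈ D) :
    ((∀ k : ℕ, 1 ≤ k → DistinctExpansions B D k) ∧ UniformlyDiscrete (digitSetInfty B D)) ↔
      ∃ δ > 0, SeparatedExpansions B D δ := by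
  constructor
  · rintro ⟨hd, δ, hδ, hu⟩
    refine ⟨δ, hδ, fun k l l' hl => ?_⟩
    rcases Nat.eq_zero_or_pos k with hk | hk
    · subst hk
      exact absurd (Subsingleton.elim _ _) hl
    · have hmem : ∀ l : Fin k → D, expansion B D l ∈ digitSetInfty B D := fun l =>
        Set.mem_iUnion₂.2 ⟨k, hk, l, rfl⟩
      exact hu _ (hmem l) _ (hmem l') fun h => hl (hd k hk h)
  · rintro ⟨δ, hδ, hs⟩
    refine ⟨fun k _ l l' h => ?_, δ, hδ, fun x hx y hy hxy => ?_⟩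
    · by_contra hne
      have := hs k l l' hne
      simp only at h
      rw [h, sub_self, norm_zero] at this
      exact lt_asymm hδ this
    · obtain ⟨s, _, l, rfl⟩ := Set.mem_iUnion₂.1 hx
      obtain ⟨t, _, l', rfl⟩ := Set.mem_iUnion₂.1 hy
      -- Trailing zero digits bring both words to the common length s + t without changing their
      -- values.
      have h1 := expansion_append B D l (fun _ : Fin t => (⟨0, h0⟩ : D))
      have h2 := expansion_append B D l' (fun _ : Fin s => (⟨0, h0⟩ : D))
      rw [expansion_const_zero, map_zero, add_zero] at h1 h2
      rw [← expansion_cast B D (add_comm s t)] at h2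
      simp only at hxy ⊢
      rw [← h1, ← h2] at hxy ⊢
      exact hs _ _ _ fun h => hxy (by rw [h])

/-- The translates of V by expansions of distinct words of equal length are disjoint. As V contains
a ball about v, two such expansions cannot be closer than its radius. -/
theorem IsExpanding.separatedExpansions_of_openSetCondition {n : ℕ}
    {B : Matrix (Fin n) (Fin n) ℝ} (hB : IsExpanding B) {D : Finset (E n)}
    (h : OpenSetCondition B D) : ∃ δ > 0, SeparatedExpansions B D δ := by
  obtain ⟨V, hVo, ⟨v, hv⟩, -, hsub, hdisj⟩ := h
  have hsub' : ∀ d : D, ∀ x ∈ V, ∃ y ∈ V, x + d = act B y := fun d x hx =>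
    ⟨ifsMap B d x, hsub (Set.mem_iUnion₂.2 ⟨d, d.2, x, hx, rfl⟩), (hB.act_inv _).symm⟩
  have key : ∀ (k : ℕ) (l l' : Fin k → D), l ≠ l' → ∀ x ∈ V, ∀ y ∈ V,
      x + expansion B D l ≠ y + expansion B D l' := by
    intro k
    induction k with
    | zero => exact fun l l' hl => absurd (Subsingleton.elim _ _) hl
    | succ k ih =>
      intro l l' hl x hx y hy hxy
      rw [← Fin.cons_self_tail l, ← Fin.cons_self_tail l', expansion_cons, expansion_cons,
        ← add_assoc, ← add_assoc] at hxy
      -- Equal tails cancel and leave two different first digits, which the disjointness condition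
      -- excludes. Otherwise V + d ⊆ B V absorbs the first digits, and B cancels.
      by_cases ht : Fin.tail l = Fin.tail l'
      · have hd : l 0 ≠ l' 0 := fun hd => hl (by
          rw [← Fin.cons_self_tail l, ← Fin.cons_self_tail l', hd, ht])
        rw [ht] at hxy
        have hxy' := add_right_cancel hxy
        refine Set.disjoint_left.1 (hdisj _ (l 0).2 _ (l' 0).2 fun h => hd (Subtype.ext h))
          ⟨x, hx, rfl⟩ ⟨y, hy, ?_⟩
        simp only [ifsMap]
        rw [hxy']
      · obtain ⟨x', hx', hxe⟩ := hsub' (l 0) x hx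
        obtain ⟨y', hy', hye⟩ := hsub' (l' 0) y hy
        rw [hxe, hye, ← map_add, ← map_add] at hxy
        have := congrArg (act B⁻¹) hxy
        rw [hB.inv_act, hB.inv_act] at this
        exact ih _ _ ht x' hx' y' hy' this
  obtain ⟨δ, hδ, hball⟩ := Metric.isOpen_iff.1 hVo v hv
  refine ⟨δ / 2, by positivity, fun k l l' hl => ?_⟩
  by_contra hle
  rw [not_lt] at hle
  refine key k l l' hl v hv (v + (expansion B D l - expansion B D l')) (hball ?_) (by abel)
  rw [mem_ball_iff_norm, add_sub_cancel_left]
  linarith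

/-! ### Separation and the Lebesgue measure of K -/

/-- This iterates B K = K + D: if y = B⁻¹(z + d), then B^{k+1} y = B^k z + B^k d, so the new digit
is the last one. -/
theorem IsExpanding.act_pow_image_selfAffineSet {n : ℕ} {B : Matrix (Fin n) (Fin n) ℝ}
    (hB : IsExpanding B) {D : Finset (E n)} {K : Set (E n)} (hK : IsSelfAffineSet B D K) (k : ℕ) :
    act (B ^ k) '' K = ⋃ l : Fin k → D, (fun x => x + expansion B D l) '' K := by
  have hmem : ∀ x, x ∈ K ↔ ∃ d : D, ∃ y ∈ K, act B⁻¹ (y + d) = x := fun x => by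
    conv_lhs => rw [hK.2.2]
    simp [ifsMap]
  induction k with
  | zero =>
    ext x
    simp [expansion, act_one_apply]
  | succ k ih =>
    ext x
    simp only [Set.ext_iff, Set.mem_image, Set.mem_iUnion] at ih ⊢
    constructor
    · rintro ⟨y, hy, rfl⟩
      obtain ⟨d, z, hz, rfl⟩ := (hmem y).1 hy
      obtain ⟨l, w, hw, hwe⟩ := (ih (act (B ^ k) z)).1 ⟨z, hz, rfl⟩
      refine ⟨Fin.snoc (α := fun _ => D) l d, w, hw, ?_⟩
      rw [expansion_snoc, ← add_assoc, hwe, pow_succ, act_mul_apply, hB.act_inv, map_add]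
    · rintro ⟨l, w, hw, rfl⟩
      obtain ⟨z, hz, hze⟩ := (ih (w + expansion B D (Fin.init (α := fun _ => D) l))).2
        ⟨_, w, hw, rfl⟩
      refine ⟨act B⁻¹ (z + l (Fin.last k)), (hmem _).2 ⟨_, z, hz, rfl⟩, ?_⟩
      conv_rhs => rw [← Fin.snoc_init_self (α := fun _ => D) l]
      rw [expansion_snoc, ← add_assoc, ← hze, pow_succ, act_mul_apply, hB.act_inv, map_add]

theorem IsExpanding.volume_pos_of_separatedExpansions {n : ℕ} {B : Matrix (Fin n) (Fin n) ℝ}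
    (hB : IsExpanding B) {D : Finset (E n)} (hcard : (D.card : ℝ) = |B.det|) {K : Set (E n)}
    (hK : IsSelfAffineSet B D K) {δ : ℝ} (hδ : 0 < δ) (hs : SeparatedExpansions B D δ) :
    0 < volume K := by
  obtain ⟨y₀, hy₀⟩ := hK.1
  set c := volume (Metric.ball (0 : E n) (δ / 2)) with hc
  have hc0 : 0 < c := Metric.measure_ball_pos _ _ (half_pos hδ)
  have hm : (D.card : ENNReal) ≠ 0 := by
    intro h
    have : (D.card : ℝ) = 0 := by exact_mod_cast h
    rw [hcard, abs_eq_zero] at this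
    exact hB.isUnit_det.ne_zero this
  -- The m^k balls are disjoint, and B^{-k} divides volume by exactly m^k.
  have hvol : ∀ k : ℕ, volume (act (B⁻¹ ^ k) ''
      ⋃ l : Fin k → D, Metric.ball (expansion B D l) (δ / 2)) = c := by
    intro k
    have h1 := volume_act_pow_image hcard k (act (B⁻¹ ^ k) ''
      ⋃ l : Fin k → D, Metric.ball (expansion B D l) (δ / 2))
    rw [Set.image_image] at h1
    simp only [hB.act_pow_inv_pow, Set.image_id'] at h1
    rw [measure_iUnion _ fun _ => measurableSet_ball] at h1
    · simp only [Measure.addHaar_ball_center, tsum_fintype, Finset.sum_const, Finset.card_univ,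
        Fintype.card_fun, Fintype.card_coe, Fintype.card_fin, nsmul_eq_mul, Nat.cast_pow] at h1
      exact ((ENNReal.mul_right_inj (pow_ne_zero _ hm)
        (ENNReal.pow_ne_top (ENNReal.natCast_ne_top _))).1 h1).symm
    · intro l l' hl
      refine Metric.ball_disjoint_ball ?_
      rw [add_halves, dist_eq_norm]
      exact (hs k l l' hl).le
  -- Each point of the balls is within δ/2 + ‖y₀‖ of B^k K, and B^{-k} contracts this distance to 0.
  -- Letting ε → 0 then gives c ≤ |K|.
  have hle : ∀ ε > 0, c ≤ volume (Metric.cthickening ε K) := by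
    intro ε hε
    have ht := hB.tendsto_norm_inv_pow.mul_const (δ / 2 + ‖y₀‖)
    rw [zero_mul] at ht
    obtain ⟨k, hk⟩ := (ht.eventually (gt_mem_nhds hε)).exists
    rw [← hvol k]
    refine measure_mono ?_
    rintro _ ⟨p, hp, rfl⟩
    obtain ⟨l, hl⟩ := Set.mem_iUnion.1 hp
    have hmem : y₀ + expansion B D l ∈ act (B ^ k) '' K := by
      rw [hB.act_pow_image_selfAffineSet hK]
      exact Set.mem_iUnion.2 ⟨l, y₀, hy₀, rfl⟩
    obtain ⟨z, hz, hze⟩ := hmem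
    refine Metric.mem_cthickening_of_dist_le _ z _ _ hz ?_
    rw [← hB.act_inv_pow_pow k z, hze, dist_eq_norm, ← map_sub]
    refine (ContinuousLinearMap.le_opNorm _ _).trans (le_trans ?_ hk.le)
    gcongr
    rw [mem_ball_iff_norm] at hl
    calc ‖p - (y₀ + expansion B D l)‖ = ‖(p - expansion B D l) - y₀‖ := by congr 1; abel
      _ ≤ ‖p - expansion B D l‖ + ‖y₀‖ := norm_sub_le _ _
      _ ≤ δ / 2 + ‖y₀‖ := by gcongr
  have hlim := (tendsto_measure_cthickening_of_isCompact (μ := volume) hK.2.1).mono_left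
    (nhdsWithin_le_nhds (s := Set.Ioi 0))
  exact hc0.trans_le (ge_of_tendsto hlim (eventually_mem_nhdsWithin.mono hle))

/-- A union as large as the sum of finite measures leaves no room for overlap: any overlap of two
members would be counted twice in the sum. -/
theorem measure_inter_eq_zero_of_sum_le {α ι : Type*} [MeasurableSpace α] [Fintype ι]
    (ν : Measure α) {f : ι → Set α} (hf : ∀ i, MeasurableSet (f i)) (hfin : ∀ i, ν (f i) ≠ ⊤)
    (h : ∑ i, ν (f i) ≤ ν (⋃ i, f i)) {i j : ι} (hij : i ≠ j) : ν (f i ∩ f j) = 0 := by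
  classical
  have hj : j ∈ Finset.univ.erase i := Finset.mem_erase.2 ⟨hij.symm, Finset.mem_univ _⟩
  set R := ∑ k ∈ (Finset.univ.erase i).erase j, ν (f k) with hR
  have hRfin : R ≠ ⊤ := ENNReal.sum_ne_top.2 fun k _ => hfin k
  have hsum : ∑ k, ν (f k) = ν (f i) + ν (f j) + R := by
    rw [← Finset.add_sum_erase _ _ (Finset.mem_univ i), ← Finset.add_sum_erase _ _ hj, add_assoc]
  have hun : ν (⋃ k, f k) ≤ ν (f i ∪ f j) + R := by
    refine le_trans (measure_mono ?_) ((measure_union_le _ (⋃ k ∈ (Finset.univ.erase i).erase j,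
      f k)).trans (add_le_add_right (measure_biUnion_finset_le _ _) _))
    intro x hx
    obtain ⟨k, hk⟩ := Set.mem_iUnion.1 hx
    by_cases hki : k = i
    · exact Or.inl (Or.inl (hki ▸ hk))
    by_cases hkj : k = j
    · exact Or.inl (Or.inr (hkj ▸ hk))
    · exact Or.inr (Set.mem_iUnion₂.2 ⟨k, by simp [hki, hkj], hk⟩)
  have h1 : ν (f i) + ν (f j) ≤ ν (f i ∪ f j) :=
    (ENNReal.add_le_add_iff_right hRfin).1 (hsum ▸ h.trans hun)
  rw [← measure_union_add_inter (f i) (hf j)] at h1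
  have hu : ν (f i ∪ f j) ≠ ⊤ :=
    ne_top_of_le_ne_top (ENNReal.add_ne_top.2 ⟨hfin i, hfin j⟩) (measure_union_le _ _)
  have h2 : ν (f i ∪ f j) + ν (f i ∩ f j) ≤ ν (f i ∪ f j) + 0 := by rwa [add_zero]
  exact le_antisymm ((ENNReal.add_le_add_iff_left hu).1 h2) (zero_le)

theorem volume_translate {n : ℕ} (S : Set (E n)) (v : E n) :
    volume ((fun x => x + v) '' S) = volume S := by
  rw [Set.image_add_right, measure_preimage_add_right]

theorem IsExpanding.volume_translate_inter_eq_zero {n : ℕ} {B : Matrix (Fin n) (Fin n) ℝ}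
    (hB : IsExpanding B) {D : Finset (E n)} (hcard : (D.card : ℝ) = |B.det|) {K : Set (E n)}
    (hK : IsSelfAffineSet B D K) {k : ℕ} {l l' : Fin k → D} (hl : l ≠ l') :
    volume ((fun x => x + expansion B D l) '' K ∩ (fun x => x + expansion B D l') '' K) = 0 := by
  refine measure_inter_eq_zero_of_sum_le volume
    (f := fun l : Fin k → D => (fun x => x + expansion B D l) '' K)
    (fun l => (hK.2.1.image (continuous_id.add continuous_const)).measurableSet) (fun l => ?_) ?_ hl
  · rw [volume_translate]
    exact hK.2.1.measure_ne_top
  · rw [← hB.act_pow_image_selfAffineSet hK, volume_act_pow_image hcard]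
    simp

/-- By outer regularity K has an open neighbourhood U with |U| < 2|K|. Two close translates of K lie
in one translate of U, so they cannot be disjoint up to a null set. -/
theorem exists_volume_translate_inter_ne_zero {n : ℕ} {K : Set (E n)} (hK : IsCompact K)
    (hpos : 0 < volume K) : ∃ δ > 0, ∀ v w : E n, ‖v - w‖ < δ →
      volume ((fun x => x + v) '' K ∩ (fun x => x + w) '' K) ≠ 0 := by
  have hfin : volume K ≠ ⊤ := hK.measure_ne_top
  obtain ⟨U, hKU, hU, hUlt⟩ := K.exists_isOpen_lt_of_lt (volume K + volume K)
    (ENNReal.lt_add_right hfin hpos.ne')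
  obtain ⟨δ, hδ, hsub⟩ := hK.exists_thickening_subset_open hU hKU
  refine ⟨δ, hδ, fun v w hvw h => ?_⟩
  have hms : ∀ u : E n, MeasurableSet ((fun x => x + u) '' K) := fun u =>
    (hK.image (continuous_id.add continuous_const)).measurableSet
  have h1 := measure_union_add_inter (μ := volume) ((fun x => x + v) '' K) (hms w)
  rw [h, add_zero, volume_translate, volume_translate] at h1
  have h2 : volume ((fun x => x + v) '' K ∪ (fun x => x + w) '' K) ≤ volume U := by
    rw [← volume_translate U w]
    refine measure_mono (Set.union_subset ?_ (Set.image_mono hKU))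
    rintro _ ⟨x, hx, rfl⟩
    refine ⟨x + (v - w), hsub (Metric.mem_thickening_iff.2 ⟨x, hx, ?_⟩), ?_⟩
    · rwa [dist_eq_norm, add_sub_cancel_left]
    · simp only; abel
  exact absurd (h1 ▸ h2) (not_le.2 hUlt)

theorem IsExpanding.separatedExpansions_of_volume_pos {n : ℕ} {B : Matrix (Fin n) (Fin n) ℝ}
    (hB : IsExpanding B) {D : Finset (E n)} (hcard : (D.card : ℝ) = |B.det|) {K : Set (E n)}
    (hK : IsSelfAffineSet B D K) (hpos : 0 < volume K) : ∃ δ > 0, SeparatedExpansions B D δ := by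
  obtain ⟨δ, hδ, h⟩ := exists_volume_translate_inter_ne_zero hK.2.1 hpos
  refine ⟨δ / 2, half_pos hδ, fun k l l' hl => ?_⟩
  by_contra hle
  exact h _ _ (by linarith) (hB.volume_translate_inter_eq_zero hcard hK hl)

/-! ### Separation and translation-boundedness -/

-- A ball of radius δ/2 holds the expansion of at most one word of each length, so the size of a
-- finite cover of C serves as M for every length and every translate.
open Classical in
theorem SeparatedExpansions.exists_card_le {n : ℕ} {B : Matrix (Fin n) (Fin n) ℝ}
    {D : Finset (E n)} {δ : ℝ} (hδ : 0 < δ) (hs : SeparatedExpansions B D δ) {C : Set (E n)}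
    (hC : IsCompact C) : ∃ M : ℕ, ∀ (k : ℕ) (z : E n),
      (Finset.univ.filter fun l : Fin k → D => expansion B D l ∈ (fun x => x + z) '' C).card
        ≤ M := by
  obtain ⟨t, -, htf, hCt⟩ := hC.finite_cover_balls (half_pos hδ)
  refine ⟨htf.toFinset.card, fun k z => ?_⟩
  have hex : ∀ l : Fin k → D, expansion B D l ∈ (fun x => x + z) '' C →
      ∃ c ∈ t, dist (expansion B D l) (c + z) < δ / 2 := by
    rintro l ⟨x, hx, hxe⟩
    obtain ⟨c, hc, hxc⟩ := Set.mem_iUnion₂.1 (hCt hx)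
    refine ⟨c, hc, ?_⟩
    rw [← hxe, dist_add_right]
    exact hxc
  choose! f hft hf using hex
  refine Finset.card_le_card_of_injOn f (fun l hl => ?_) fun l hl l' hl' hll => ?_
  · simp only [Finset.coe_filter, Finset.mem_univ, true_and, Set.mem_ofPred_eq] at hl
    simpa using hft l hl
  · simp only [Finset.coe_filter, Finset.mem_univ, true_and, Set.mem_ofPred_eq] at hl hl'
    by_contra hne
    have h1 := hf l hl
    have h2 := hf l' hl'
    rw [← hll] at h2
    have h3 := hs k l l' hne
    rw [← dist_eq_norm] at h3
    linarith [dist_triangle_right (expansion B D l) (expansion B D l') (f l + z)]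

open Classical in
theorem partialMeasure_apply {n : ℕ} (B : Matrix (Fin n) (Fin n) ℝ) (D : Finset (E n)) (s : ℕ)
    {A : Set (E n)} (hA : MeasurableSet A) : partialMeasure B D s A =
      ((Finset.univ.filter fun l : Fin s → D => expansion B D l ∈ A).card : ENNReal) := by
  simp only [partialMeasure, Measure.coe_finsetSum, Finset.sum_apply, Measure.dirac_apply' _ hA,
    Set.indicator_apply, Pi.one_apply, Finset.sum_boole]

theorem SeparatedExpansions.translationBounded {n : ℕ} {B : Matrix (Fin n) (Fin n) ℝ}
    {D : Finset (E n)} (h0 : (0 : E n) ∈ D) {δ : ℝ} (hδ : 0 < δ) (hs : SeparatedExpansions B D δ) :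
    TranslationBounded (digitMeasure B D) := by
  intro C hC
  obtain ⟨M, hM⟩ := hs.exists_card_le hδ hC
  refine ⟨M, fun z => ?_⟩
  have hm : MeasurableSet ((fun x => x + z) '' C) :=
    (hC.image (continuous_id.add continuous_const)).measurableSet
  rw [digitMeasure_apply B h0 hm]
  refine iSup_le fun s => ?_
  rw [partialMeasure_apply B D s hm]
  exact_mod_cast hM s z

/-- Doubling: appending either word of a very close pair to 2^M words clustered near p gives 2^(M+1)
clustered words. Words are counted, not points, so coinciding expansions do no harm. -/
theorem exists_card_of_not_separatedExpansions {n : ℕ} {B : Matrix (Fin n) (Fin n) ℝ}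
    {D : Finset (E n)} (h : ¬ ∃ δ > 0, SeparatedExpansions B D δ) (M : ℕ) :
    ∃ (k : ℕ) (p : E n) (S : Finset (Fin k → D)) (r : ℝ), r < 1 ∧ S.card = 2 ^ M ∧
      ∀ l ∈ S, ‖expansion B D l - p‖ ≤ r := by
  classical
  induction M with
  | zero => exact ⟨0, 0, {Fin.elim0}, 0, one_pos, rfl, by simp [expansion]⟩
  | succ M ih =>
    obtain ⟨k, p, S, r, hr, hS, hSr⟩ := ih
    set N := ‖act (B ^ k)‖ with hN
    have hN0 : 0 ≤ N := norm_nonneg _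
    -- The appended pair is shifted by B^k, which stretches its gap by at most N; this δ keeps the
    -- new radius r + Nδ below 1.
    set δ := (1 - r) / (2 * (N + 1)) with hδ
    have hδ0 : 0 < δ := div_pos (by linarith) (by positivity)
    have hNδ : r + N * δ < 1 := by
      have : 2 * (N + 1) * δ = 1 - r := by rw [hδ]; field_simp
      nlinarith
    have h' : ¬ SeparatedExpansions B D δ := fun hs => h ⟨δ, hδ0, hs⟩
    simp only [SeparatedExpansions, not_forall, not_lt] at h'
    obtain ⟨k', l, l', hl, hle⟩ := h'
    refine ⟨k + k', p + act (B ^ k) (expansion B D l'),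
      (S ×ˢ {l, l'}).image (fun q => Fin.append q.1 q.2), r + N * δ, hNδ, ?_, ?_⟩
    · rw [Finset.card_image_of_injective, Finset.card_product, hS, Finset.card_pair hl, pow_succ]
      rintro ⟨a, b⟩ ⟨a', b'⟩ hab
      simp only at hab
      have h1 : a = a' := funext fun i => by
        simpa using congrFun hab (Fin.castAdd k' i)
      have h2 : b = b' := funext fun i => by
        simpa using congrFun hab (Fin.natAdd k i)
      rw [h1, h2]
    · intro w hw
      obtain ⟨⟨a, b⟩, hab, rfl⟩ := Finset.mem_image.1 hw
      rw [Finset.mem_product] at hab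
      have hb : ‖expansion B D b - expansion B D l'‖ ≤ δ := by
        have hb : b = l ∨ b = l' := by simpa using hab.2
        rcases hb with rfl | rfl
        · exact hle
        · rw [sub_self, norm_zero]
          exact hδ0.le
      simp only
      rw [expansion_append, add_sub_add_comm, ← map_sub]
      refine (norm_add_le _ _).trans (add_le_add (hSr a hab.1) ?_)
      refine (ContinuousLinearMap.le_opNorm _ _).trans ?_
      gcongr

theorem TranslationBounded.exists_separatedExpansions {n : ℕ} {B : Matrix (Fin n) (Fin n) ℝ}
    {D : Finset (E n)} (ht : TranslationBounded (digitMeasure B D)) :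
    ∃ δ > 0, SeparatedExpansions B D δ := by
  classical
  by_contra h
  obtain ⟨c, hc⟩ := ht (Metric.closedBall 0 1) (isCompact_closedBall _ _)
  obtain ⟨M, hM⟩ := exists_nat_gt c
  obtain ⟨k, p, S, r, hr, hS, hSr⟩ := exists_card_of_not_separatedExpansions h M
  have himg : (fun x => x + p) '' Metric.closedBall (0 : E n) 1 = Metric.closedBall p 1 := by
    simp [Set.image_add_right, sub_eq_add_neg]
  have h1 : partialMeasure B D k (Metric.closedBall p 1) ≤ c :=
    (le_iSup (partialMeasure B D) k _).trans (himg ▸ hc p)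
  rw [partialMeasure_apply B D k Metric.isClosed_closedBall.measurableSet] at h1
  have h2 : S.card ≤ (Finset.univ.filter fun l : Fin k → D =>
      expansion B D l ∈ Metric.closedBall p 1).card := Finset.card_le_card fun l hl => by
    simp only [Finset.mem_filter, Finset.mem_univ, true_and, mem_closedBall_iff_norm]
    exact (hSr l hl).trans hr.le
  have h3 : (M : NNReal) ≤ c := by
    have : (M : ENNReal) ≤ c := le_trans (by
      exact_mod_cast (Nat.lt_two_pow_self.le.trans (hS ▸ h2))) h1
    exact_mod_cast this
  exact absurd h3 (not_le.2 hM)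

/-! ### Cubes and the upper Beurling density -/

theorem cube_eq_preimage {n : ℕ} (N : ℝ) (z : E n) :
    cube N z = (WithLp.ofLp : E n → Fin n → ℝ) ⁻¹'
      Set.Icc (fun i => z i - N / 2) (fun i => z i + N / 2) := by
  ext y
  simp only [cube, Set.mem_ofPred_eq, Set.mem_preimage, Set.mem_Icc, Pi.le_def, ← forall_and,
    abs_le]
  refine forall_congr' fun i => ⟨fun h => ⟨?_, ?_⟩, fun h => ⟨?_, ?_⟩⟩ <;> linarith [h.1, h.2]

theorem measurableSet_cube {n : ℕ} (N : ℝ) (z : E n) : MeasurableSet (cube N z) := by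
  rw [cube_eq_preimage]
  exact (PiLp.volume_preserving_ofLp (Fin n)).measurable measurableSet_Icc

theorem volume_cube {n : ℕ} {N : ℝ} (hN : 0 ≤ N) (z : E n) :
    volume (cube N z) = ENNReal.ofReal (N ^ n) := by
  rw [cube_eq_preimage, (PiLp.volume_preserving_ofLp (Fin n)).measure_preimage
    measurableSet_Icc.nullMeasurableSet, Real.volume_Icc_pi]
  have : ∀ i, z i + N / 2 - (z i - N / 2) = N := fun i => by ring
  simp only [this, Finset.prod_const, Finset.card_univ, Fintype.card_fin]
  rw [ENNReal.ofReal_pow hN]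

theorem mem_cube_comm {n : ℕ} {N : ℝ} {y z : E n} : y ∈ cube N z ↔ z ∈ cube N y := by
  simp only [cube, Set.mem_ofPred_eq, abs_sub_comm]

/-- Double counting: integrate over w in T the number of words with expansion in the cube about w.
Each word with expansion in S contributes a full N^n, by symmetry of membership in cubes, while the
integrand is at most c. -/
theorem partialMeasure_mul_le {n : ℕ} (B : Matrix (Fin n) (Fin n) ℝ) (D : Finset (E n)) (s : ℕ)
    {N : ℝ} (hN : 0 ≤ N) {S T : Set (E n)} (hS : MeasurableSet S)
    (hST : ∀ x ∈ S, cube N x ⊆ T) {c : ENNReal} (hc : ∀ w, partialMeasure B D s (cube N w) ≤ c) :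
    partialMeasure B D s S * ENNReal.ofReal (N ^ n) ≤ c * volume T := by
  classical
  calc partialMeasure B D s S * ENNReal.ofReal (N ^ n)
      = ∑ l ∈ Finset.univ.filter fun l : Fin s → D => expansion B D l ∈ S,
          volume (cube N (expansion B D l) ∩ T) := by
        rw [partialMeasure_apply B D s hS, ← nsmul_eq_mul, ← Finset.sum_const]
        refine Finset.sum_congr rfl fun l hl => ?_
        rw [Set.inter_eq_left.2 (hST _ (Finset.mem_filter.1 hl).2), volume_cube hN]
    _ ≤ ∑ l : Fin s → D, volume (cube N (expansion B D l) ∩ T) :=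
        Finset.sum_le_sum_of_subset (Finset.subset_univ _)
    _ = ∑ l : Fin s → D, ∫⁻ w in T, (cube N (expansion B D l)).indicator 1 w := by
        refine Finset.sum_congr rfl fun l _ => ?_
        rw [lintegral_indicator_one (measurableSet_cube _ _),
          Measure.restrict_apply (measurableSet_cube _ _)]
    _ = ∫⁻ w in T, ∑ l : Fin s → D, (cube N (expansion B D l)).indicator 1 w :=
        (lintegral_finsetSum _ fun l _ =>
          measurable_one.indicator (measurableSet_cube _ _)).symm
    _ ≤ ∫⁻ _ in T, c := by
        refine lintegral_mono fun w => le_trans (le_of_eq ?_) (hc w)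
        rw [partialMeasure_apply B D s (measurableSet_cube _ _), ← Finset.sum_boole]
        refine Finset.sum_congr rfl fun l _ => ?_
        simp only [Set.indicator_apply, mem_cube_comm (y := w), Pi.one_apply]
    _ = c * volume T := setLIntegral_const _ _

theorem cube_subset_closedBall {n : ℕ} (N : ℝ) : ∃ R : ℝ, ∀ z : E n,
    cube N z ⊆ Metric.closedBall z R := by
  refine ⟨√(∑ _i : Fin n, (N / 2) ^ 2), fun z y hy => ?_⟩
  rw [Metric.mem_closedBall, EuclideanSpace.dist_eq]
  refine Real.sqrt_le_sqrt (Finset.sum_le_sum fun i _ => ?_)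
  rw [Real.dist_eq]
  exact pow_le_pow_left₀ (abs_nonneg _) (hy i) 2

theorem ball_subset_cube {n : ℕ} (N : ℝ) (z : E n) : Metric.ball z (N / 2) ⊆ cube N z := by
  intro y hy i
  rw [mem_ball_iff_norm] at hy
  exact (PiLp.norm_apply_le (y - z) i).trans hy.le

theorem cube_add_subset {n : ℕ} {N M : ℝ} {x z : E n} (hx : x ∈ cube N z) :
    cube M x ⊆ cube (N + M) z := by
  intro y hy i
  have h1 := hx i
  have h2 := hy i
  linarith [abs_sub_le (y i) (x i) (z i)]

theorem translate_cube {n : ℕ} (N : ℝ) (z : E n) :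
    (fun x => x + z) '' cube N 0 = cube N z := by
  ext y
  simp [Set.image_add_right, cube, sub_eq_add_neg]

theorem isCompact_cube {n : ℕ} (N : ℝ) (z : E n) : IsCompact (cube N z) := by
  obtain ⟨R, hR⟩ := cube_subset_closedBall (n := n) N
  refine (isCompact_closedBall z R).of_isClosed_subset ?_ (hR z)
  rw [cube_eq_preimage]
  exact isClosed_Icc.preimage (PiLp.continuous_ofLp 2 _)

theorem TranslationBounded.upperBeurlingDensity_lt_top {n : ℕ} {B : Matrix (Fin n) (Fin n) ℝ}
    {D : Finset (E n)} (h0 : (0 : E n) ∈ D) (ht : TranslationBounded (digitMeasure B D)) :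
    upperBeurlingDensity (digitMeasure B D) < ⊤ := by
  obtain ⟨c, hc⟩ := ht (cube 1 0) (isCompact_cube 1 0)
  simp only [translate_cube] at hc
  have hbound : ∀ N : ℝ, 1 ≤ N → ∀ z : E n,
      digitMeasure B D (cube N z) ≤ c * ENNReal.ofReal ((2 * N) ^ n) := by
    intro N hN z
    rw [digitMeasure_apply B h0 (measurableSet_cube _ _)]
    refine iSup_le fun s => ?_
    -- Averaging with unit cubes bounds the mass of a cube of side N by c(N + 1)^n, and N + 1 ≤ 2N.
    have h := partialMeasure_mul_le B D s zero_le_one (measurableSet_cube N z)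
      (T := cube (N + 1) z) (fun x hx => cube_add_subset hx) (c := c)
      (fun w => (le_iSup (partialMeasure B D) s _).trans (hc w))
    rw [one_pow, ENNReal.ofReal_one, mul_one, volume_cube (by linarith)] at h
    refine h.trans ?_
    gcongr
    linarith
  have hle : upperBeurlingDensity (digitMeasure B D) ≤ c * ENNReal.ofReal (2 ^ n) := by
    refine limsup_le_of_le (by isBoundedDefault) ?_
    filter_upwards [eventually_ge_atTop (1 : ℝ)] with N hN
    refine iSup_le fun z => ENNReal.div_le_of_le_mul ?_
    rw [mul_assoc, ← ENNReal.ofReal_mul (by positivity), ← mul_pow]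
    exact hbound N hN z
  exact hle.trans_lt (ENNReal.mul_lt_top ENNReal.coe_lt_top ENNReal.ofReal_lt_top)

/-- A finite limsup provides one scale N at which all cubes have uniformly bounded mass; finitely
many such cubes cover a compact set, and the cover moves with its translates. -/
theorem translationBounded_of_upperBeurlingDensity_lt_top {n : ℕ} {ν : Measure (E n)}
    (h : upperBeurlingDensity ν < ⊤) : TranslationBounded ν := by
  obtain ⟨c, hc, hctop⟩ := exists_between h
  obtain ⟨N, hN, hN1⟩ := ((eventually_lt_of_limsup_lt hc).and
    (eventually_ge_atTop (1 : ℝ))).exists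
  have hNn : (0 : ℝ) < N ^ n := by positivity
  have hcube : ∀ z, ν (cube N z) ≤ c * ENNReal.ofReal (N ^ n) := fun z => by
    rw [← ENNReal.div_le_iff (ENNReal.ofReal_pos.2 hNn).ne' ENNReal.ofReal_ne_top]
    exact (le_iSup (fun z : E n => ν (cube N z) / ENNReal.ofReal (N ^ n)) z).trans hN.le
  intro K hK
  obtain ⟨t, -, htf, hKt⟩ := hK.finite_cover_balls (half_pos (zero_lt_one.trans_le hN1))
  lift c * ENNReal.ofReal (N ^ n) to NNReal using
    (ENNReal.mul_lt_top hctop ENNReal.ofReal_lt_top).ne with C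
  refine ⟨htf.toFinset.card * C, fun z => ?_⟩
  calc ν ((fun x => x + z) '' K) ≤ ν (⋃ x ∈ htf.toFinset, cube N (x + z)) := by
        refine measure_mono ?_
        rintro _ ⟨y, hy, rfl⟩
        obtain ⟨x, hx, hyx⟩ := Set.mem_iUnion₂.1 (hKt hy)
        refine Set.mem_iUnion₂.2 ⟨x, htf.mem_toFinset.2 hx, ball_subset_cube _ _ ?_⟩
        rwa [Metric.mem_ball, dist_add_right]
    _ ≤ ∑ x ∈ htf.toFinset, ν (cube N (x + z)) := measure_biUnion_finset_le _ _
    _ ≤ ∑ _x ∈ htf.toFinset, (C : ENNReal) := Finset.sum_le_sum fun x _ => hcube _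
    _ = _ := by simp

/-- For fixed N and large k, the cubes of side N about all m^k expansions lie in B^k of a fixed ball
of volume c, a set of volume m^k c. Averaging yields a cube of normalised mass at least about 1/c,
for every N. -/
theorem IsExpanding.upperBeurlingDensity_pos {n : ℕ} {B : Matrix (Fin n) (Fin n) ℝ}
    (hB : IsExpanding B) {D : Finset (E n)} (h0 : (0 : E n) ∈ D)
    (hcard : (D.card : ℝ) = |B.det|) : 0 < upperBeurlingDensity (digitMeasure B D) := by
  have hDpos : (D.card : ENNReal) ≠ 0 := by
    exact_mod_cast (Finset.card_pos.2 ⟨0, h0⟩).ne'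
  have hK := isSelfAffineSet_selfAffineSet hB ⟨0, h0⟩
  obtain ⟨R, hR0, hR⟩ := hK.2.1.isBounded.exists_pos_norm_le
  obtain ⟨y₀, hy₀⟩ := hK.1
  set c := volume (Metric.ball (0 : E n) (R + 1)) with hcdef
  have hc0 : c ≠ 0 := (Metric.measure_ball_pos _ _ (by linarith)).ne'
  have hctop : c ≠ ⊤ := measure_ball_lt_top.ne
  have hlow : ∀ N : ℝ, 0 < N → c⁻¹ ≤ ⨆ z : E n,
      digitMeasure B D (cube N z) / ENNReal.ofReal (N ^ n) := by
    intro N hN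
    have hNn : ENNReal.ofReal (N ^ n) ≠ 0 := (ENNReal.ofReal_pos.2 (pow_pos hN n)).ne'
    obtain ⟨r, hr⟩ := cube_subset_closedBall (n := n) N
    have hlim := hB.tendsto_norm_inv_pow.mul_const (‖y₀‖ + r)
    rw [zero_mul] at hlim
    obtain ⟨k, hk⟩ := (hlim.eventually (gt_mem_nhds one_pos)).exists
    set T := act (B ^ k) '' Metric.ball (0 : E n) (R + 1) with hT
    have hcube : ∀ l : Fin k → D, cube N (expansion B D l) ⊆ T := by
      intro l w hw
      refine ⟨act (B⁻¹ ^ k) w, ?_, hB.act_pow_inv_pow k w⟩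
      obtain ⟨z, hz, hze⟩ : y₀ + expansion B D l ∈ act (B ^ k) '' selfAffineSet B D := by
        rw [hB.act_pow_image_selfAffineSet hK]
        exact Set.mem_iUnion.2 ⟨l, y₀, hy₀, rfl⟩
      have hw' : w = act (B ^ k) z + ((w - expansion B D l) - y₀) := by
        rw [hze]; abel
      rw [hw', map_add, hB.act_inv_pow_pow, mem_ball_zero_iff]
      refine (norm_add_le _ _).trans_lt (add_lt_add_of_le_of_lt (hR z hz) ?_)
      refine lt_of_le_of_lt (ContinuousLinearMap.le_opNorm _ _) (lt_of_le_of_lt ?_ hk)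
      gcongr
      have := hr _ hw
      rw [mem_closedBall_iff_norm] at this
      linarith [norm_sub_le (w - expansion B D l) y₀]
    set A := ⨆ z : E n, digitMeasure B D (cube N z) / ENNReal.ofReal (N ^ n) with hA
    have hAle : ∀ w, partialMeasure B D k (cube N w) ≤ A * ENNReal.ofReal (N ^ n) := fun w => by
      rw [← ENNReal.div_le_iff hNn ENNReal.ofReal_ne_top]
      refine le_trans ?_ (le_iSup (fun z : E n =>
        digitMeasure B D (cube N z) / ENNReal.ofReal (N ^ n)) w)
      gcongr
      exact le_iSup (partialMeasure B D) k
    classical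
    have h := partialMeasure_mul_le B D k hN.le
      (S := Set.range fun l : Fin k → D => expansion B D l) (T := T)
      (Set.finite_range _).measurableSet (by rintro _ ⟨l, rfl⟩; exact hcube l) hAle
    rw [partialMeasure_apply B D k (Set.finite_range _).measurableSet,
      volume_act_pow_image hcard] at h
    simp only [Set.mem_range_self, Finset.filter_true, Finset.card_univ, Fintype.card_fun,
      Fintype.card_coe, Fintype.card_fin, Nat.cast_pow] at h
    have hm0 : (D.card : ENNReal) ^ k * ENNReal.ofReal (N ^ n) ≠ 0 :=
      mul_ne_zero (pow_ne_zero _ hDpos) hNn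
    have hmtop : (D.card : ENNReal) ^ k * ENNReal.ofReal (N ^ n) ≠ ⊤ :=
      ENNReal.mul_ne_top (ENNReal.pow_ne_top (ENNReal.natCast_ne_top _)) ENNReal.ofReal_ne_top
    have h2 : (D.card : ENNReal) ^ k * ENNReal.ofReal (N ^ n) * 1 ≤
        (D.card : ENNReal) ^ k * ENNReal.ofReal (N ^ n) * (A * c) := by
      rw [mul_one]
      refine h.trans (le_of_eq ?_)
      ring
    rw [ENNReal.mul_le_mul_iff_right hm0 hmtop] at h2
    exact (ENNReal.inv_le_iff_le_mul (fun _ => hc0) (fun h => absurd h hctop)).2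
      (mul_comm A c ▸ h2)
  refine (ENNReal.inv_pos.2 hctop).trans_le ?_
  refine le_limsup_of_frequently_le (Eventually.frequently ?_) (by isBoundedDefault)
  filter_upwards [eventually_gt_atTop (0 : ℝ)] with N hN using hlow N hN

/-! ### Positive measure forces non-empty interior -/

/-- Tonelli for the pairs z ∈ G, y ∉ G at distance less than r: every such y lies in the outer shell
of G and sees at most one ball's volume of points z. -/
theorem setLIntegral_volume_ball_diff_le {n : ℕ} {G : Set (E n)} (hG : MeasurableSet G) (r : ℝ) :
    ∫⁻ z in G, volume (Metric.ball z r \ G) ≤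
      volume (Metric.ball (0 : E n) r) * volume (Metric.thickening r G \ G) := by
  set P : Set (E n × E n) := (Prod.fst ⁻¹' G ∩ Prod.snd ⁻¹' Gᶜ) ∩ {p | dist p.2 p.1 < r} with hP
  have hPm : MeasurableSet P :=
    ((measurable_fst hG).inter (measurable_snd hG.compl)).inter
      (isOpen_lt (continuous_snd.dist continuous_fst) continuous_const).measurableSet
  have hTm : MeasurableSet (Metric.thickening r G \ G) :=
    Metric.isOpen_thickening.measurableSet.diff hG
  calc ∫⁻ z in G, volume (Metric.ball z r \ G)
      ≤ ∫⁻ z, volume (Prod.mk z ⁻¹' P) := by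
        rw [← lintegral_indicator hG]
        refine lintegral_mono fun z => ?_
        by_cases hz : z ∈ G
        · rw [Set.indicator_of_mem hz]
          exact measure_mono fun y hy => ⟨⟨hz, hy.2⟩, hy.1⟩
        · rw [Set.indicator_of_notMem hz]
          exact zero_le
    _ = ∫⁻ y, volume ((fun x => (x, y)) ⁻¹' P) := by
        rw [← Measure.prod_apply hPm, Measure.prod_apply_symm hPm]
    _ ≤ ∫⁻ y, (Metric.thickening r G \ G).indicator
          (fun _ => volume (Metric.ball (0 : E n) r)) y := by
        refine lintegral_mono fun y => ?_
        by_cases hy : y ∈ Metric.thickening r G \ G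
        · rw [Set.indicator_of_mem hy, ← Measure.addHaar_ball_center volume y]
          refine measure_mono fun z hz => ?_
          rw [Metric.mem_ball, dist_comm]
          exact hz.2
        · rw [Set.indicator_of_notMem hy]
          refine le_of_eq ((congrArg _ (Set.eq_empty_of_forall_notMem fun z hz => hy ?_)).trans
            measure_empty)
          exact ⟨Metric.mem_thickening_iff.2 ⟨z, hz.1.1, hz.2⟩, hz.1.2⟩
    _ = _ := by rw [lintegral_indicator hTm, setLIntegral_const]

/-- Otherwise every unit ball centred in G = B^k K contains an ε-hole of G, so the unit shell of G
has volume at least a fixed multiple of |G|. Scaled back by B^{-k}, this shell lies in a shell of K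
of width ‖B^{-k}‖ → 0, whose volume tends to 0. -/
theorem IsExpanding.exists_dense_in_ball {n : ℕ} {B : Matrix (Fin n) (Fin n) ℝ}
    (hB : IsExpanding B) {D : Finset (E n)} (h0 : (0 : E n) ∈ D)
    (hcard : (D.card : ℝ) = |B.det|) {K : Set (E n)} (hK : IsCompact K) (hpos : 0 < volume K)
    {ε : ℝ} (hε : 0 < ε) : ∃ (k : ℕ) (z : E n), ∀ w, Metric.ball w ε ⊆ Metric.ball z 1 →
      (Metric.ball w ε ∩ act (B ^ k) '' K).Nonempty := by
  by_contra! h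
  have hDpos : (D.card : ENNReal) ≠ 0 := by
    exact_mod_cast (Finset.card_pos.2 ⟨0, h0⟩).ne'
  have hfin : volume K ≠ ⊤ := hK.measure_ne_top
  set b := volume (Metric.ball (0 : E n) ε) with hb
  set c := volume (Metric.ball (0 : E n) 1) with hc
  have hb0 : 0 < b := Metric.measure_ball_pos _ _ hε
  have hctop : c ≠ ⊤ := measure_ball_lt_top.ne
  have hle : ∀ k : ℕ, b * volume K ≤
      c * (volume (Metric.cthickening ‖act (B⁻¹ ^ k)‖ K) - volume K) := by
    intro k
    set G := act (B ^ k) '' K with hG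
    have hGm : MeasurableSet G := (hK.image (act (B ^ k)).continuous).measurableSet
    have h1 : b * volume G ≤ ∫⁻ z in G, volume (Metric.ball z 1 \ G) := by
      rw [← setLIntegral_const]
      refine lintegral_mono fun z => ?_
      obtain ⟨w, hw, hwG⟩ := h k z
      simp only
      rw [hb, ← Measure.addHaar_ball_center volume w]
      exact measure_mono fun x hx => ⟨hw hx, fun hxG => Set.eq_empty_iff_forall_notMem.1 hwG x
        ⟨hx, hxG⟩⟩
    have h2 := h1.trans (setLIntegral_volume_ball_diff_le hGm 1)
    have h3 : Metric.thickening 1 G \ G ⊆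
        act (B ^ k) '' (Metric.cthickening ‖act (B⁻¹ ^ k)‖ K \ K) := by
      rintro y ⟨hy, hyG⟩
      obtain ⟨_, ⟨x, hx, rfl⟩, hyx⟩ := Metric.mem_thickening_iff.1 hy
      refine ⟨act (B⁻¹ ^ k) y, ⟨?_, fun hyK => hyG ⟨_, hyK, hB.act_pow_inv_pow k y⟩⟩,
        hB.act_pow_inv_pow k y⟩
      refine Metric.mem_cthickening_of_dist_le _ x _ _ hx ?_
      rw [dist_eq_norm] at hyx ⊢
      conv_lhs => rw [← hB.act_inv_pow_pow k x, ← map_sub]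
      exact ((act (B⁻¹ ^ k)).le_opNorm _).trans (mul_le_of_le_one_right (norm_nonneg _) hyx.le)
    have h4 := h2.trans (mul_le_mul_right (measure_mono h3) _)
    rw [volume_act_pow_image hcard, volume_act_pow_image hcard,
      measure_sdiff (Metric.self_subset_cthickening K) hK.measurableSet.nullMeasurableSet hfin,
      mul_left_comm, mul_left_comm _ ((D.card : ENNReal) ^ k)] at h4
    exact (ENNReal.mul_le_mul_iff_right (pow_ne_zero _ hDpos)
      (ENNReal.pow_ne_top (ENNReal.natCast_ne_top _))).1 h4
  have hlim : Tendsto (fun k : ℕ => c * (volume (Metric.cthickening ‖act (B⁻¹ ^ k)‖ K)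
      - volume K)) atTop (𝓝 (c * (volume K - volume K))) :=
    ENNReal.Tendsto.const_mul (ENNReal.Tendsto.sub
      ((tendsto_measure_cthickening_of_isCompact hK).comp hB.tendsto_norm_inv_pow)
      tendsto_const_nhds (Or.inl hfin)) (Or.inr hctop)
  rw [tsub_self, mul_zero] at hlim
  have := ge_of_tendsto hlim (Eventually.of_forall hle)
  exact (ENNReal.mul_pos hb0.ne' hpos.ne').not_ge this

/-- Compactness makes the hole size uniform: a ball whose concentric half misses K already contains
a hole, and any other contains the r/4-ball about a point of a finite net, where a hole has been
fixed in advance. -/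
theorem exists_ball_disjoint_of_interior_eq_empty {n : ℕ} {K : Set (E n)} (hK : IsCompact K)
    (hint : interior K = ∅) {r : ℝ} (hr : 0 < r) : ∃ ε > 0, ∀ c : E n, ∃ w,
      Metric.ball w ε ⊆ Metric.ball c r ∧ Disjoint (Metric.ball w ε) K := by
  have hex : ∀ x : E n, ∃ w, ∃ ε > 0, Metric.ball w ε ⊆ Metric.ball x (r / 4) \ K := by
    intro x
    have hne : (Metric.ball x (r / 4) \ K).Nonempty := by
      rw [Set.sdiff_nonempty]
      intro hsub
      have := interior_maximal hsub Metric.isOpen_ball (Metric.mem_ball_self (by positivity))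
      rwa [hint] at this
    obtain ⟨w, hw⟩ := hne
    obtain ⟨ε, hε, h⟩ := Metric.isOpen_iff.1 (Metric.isOpen_ball.sdiff hK.isClosed) w hw
    exact ⟨w, ε, hε, h⟩
  choose w e he hwe using hex
  obtain ⟨t, -, htf, hKt⟩ := hK.finite_cover_balls (e := r / 4) (by positivity)
  have hev : ∀ᶠ ε in 𝓝[>] (0 : ℝ), (∀ x ∈ t, ε < e x) ∧ ε < r / 2 :=
    ((eventually_all_finite htf).2 fun x _ => nhdsWithin_le_nhds (gt_mem_nhds (he x))).and
      (nhdsWithin_le_nhds (gt_mem_nhds (half_pos hr)))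
  obtain ⟨ε, ⟨hεt, hεr⟩, hε⟩ := (hev.and eventually_mem_nhdsWithin).exists
  refine ⟨ε, hε, fun c => ?_⟩
  by_cases hc : Disjoint (Metric.ball c (r / 2)) K
  · exact ⟨c, Metric.ball_subset_ball (by linarith),
      hc.mono_left (Metric.ball_subset_ball hεr.le)⟩
  · obtain ⟨y, hyc, hyK⟩ := Set.not_disjoint_iff.1 hc
    obtain ⟨x, hx, hyx⟩ := Set.mem_iUnion₂.1 (hKt hyK)
    have hsub := (Metric.ball_subset_ball (hεt x hx).le).trans (hwe x)
    refine ⟨w x, fun p hp => ?_, Set.disjoint_left.2 fun p hp => (hsub hp).2⟩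
    have hp1 := (hsub hp).1
    rw [Metric.mem_ball] at *
    linarith [dist_triangle p x c, dist_triangle_left x c y]

/-- The translates are avoided one at a time, each inside the hole left by the previous one, so ε
depends on their number and not on their positions. -/
theorem exists_ball_disjoint_translates {n : ℕ} {K : Set (E n)} (hK : IsCompact K)
    (hint : interior K = ∅) (M : ℕ) : ∀ r > 0, ∃ ε > 0, ∀ Y : Finset (E n), Y.card ≤ M →
      ∀ c : E n, ∃ w, Metric.ball w ε ⊆ Metric.ball c r ∧
        ∀ y ∈ Y, Disjoint (Metric.ball w ε) ((fun x => x + y) '' K) := by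
  classical
  induction M with
  | zero =>
    intro r hr
    refine ⟨r, hr, fun Y hY c => ⟨c, subset_rfl, ?_⟩⟩
    simp [Finset.card_eq_zero.1 (Nat.le_zero.1 hY)]
  | succ M ih =>
    intro r hr
    obtain ⟨ε₁, hε₁, h1⟩ := exists_ball_disjoint_of_interior_eq_empty hK hint hr
    obtain ⟨ε, hε, h2⟩ := ih ε₁ hε₁
    refine ⟨ε, hε, fun Y hY c => ?_⟩
    rcases Y.eq_empty_or_nonempty with rfl | ⟨y, hy⟩
    · obtain ⟨w₁, hw₁, -⟩ := h1 c
      obtain ⟨w, hw, -⟩ := h2 ∅ (by simp) w₁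
      exact ⟨w, hw.trans hw₁, by simp⟩
    -- Shifting by -y turns the translate K + y into K itself.
    · obtain ⟨w₁, hw₁, hd⟩ := h1 (c - y)
      obtain ⟨w, hw, hwd⟩ := h2 (Y.erase y) (by rw [Finset.card_erase_of_mem hy]; omega) (w₁ + y)
      have hshift : ∀ p ∈ Metric.ball w ε, p - y ∈ Metric.ball w₁ ε₁ := fun p hp => by
        have := hw hp
        rw [mem_ball_iff_norm] at this ⊢
        rwa [sub_sub, add_comm y w₁]
      refine ⟨w, fun p hp => ?_, fun y' hy' => ?_⟩
      · have := hw₁ (hshift p hp)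
        rw [mem_ball_iff_norm] at this ⊢
        rwa [sub_sub_sub_cancel_right] at this
      · by_cases hyy : y' = y
        · subst hyy
          refine Set.disjoint_left.2 ?_
          rintro _ hp ⟨x, hx, rfl⟩
          have := hshift _ hp
          rw [add_sub_cancel_right] at this
          exact Set.disjoint_left.1 hd this hx
        · exact hwd y' (Finset.mem_erase.2 ⟨hyy, hy'⟩)

theorem IsExpanding.interior_nonempty {n : ℕ} {B : Matrix (Fin n) (Fin n) ℝ}
    (hB : IsExpanding B) {D : Finset (E n)} (h0 : (0 : E n) ∈ D)
    (hcard : (D.card : ℝ) = |B.det|) {K : Set (E n)} (hK : IsSelfAffineSet B D K)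
    (hpos : 0 < volume K) : (interior K).Nonempty := by
  classical
  by_contra hne
  rw [Set.not_nonempty_iff_eq_empty] at hne
  obtain ⟨δ, hδ, hs⟩ := hB.separatedExpansions_of_volume_pos hcard hK hpos
  obtain ⟨R, -, hR⟩ := hK.2.1.isBounded.exists_pos_norm_le
  obtain ⟨M, hM⟩ := hs.exists_card_le hδ (isCompact_closedBall (0 : E n) (R + 1))
  obtain ⟨ε, hε, h⟩ := exists_ball_disjoint_translates hK.2.1 hne M 1 one_pos
  obtain ⟨k, z, hkz⟩ := hB.exists_dense_in_ball h0 hcard hK.2.1 hpos hε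
  -- As K lies in the ball of radius R, a translate of K meeting the unit ball about z has its
  -- expansion within R + 1 of z. There are at most M of these, and M was fixed before ε, k and z.
  obtain ⟨w, hw, hwd⟩ := h ((Finset.univ.filter fun l : Fin k → D =>
    expansion B D l ∈ (fun x => x + z) '' Metric.closedBall (0 : E n) (R + 1)).image
      fun l => expansion B D l) (Finset.card_image_le.trans (hM k z)) z
  obtain ⟨g, hgw, hgG⟩ := hkz w hw
  rw [hB.act_pow_image_selfAffineSet hK] at hgG
  obtain ⟨l, hl⟩ := Set.mem_iUnion.1 hgG
  refine Set.disjoint_left.1 (hwd (expansion B D l) (Finset.mem_image.2 ⟨l, ?_, rfl⟩)) hgw hl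
  obtain ⟨x, hx, hxg⟩ := hl
  simp only at hxg
  refine Finset.mem_filter.2 ⟨Finset.mem_univ _, expansion B D l - z, ?_, sub_add_cancel _ _⟩
  have hgz := hw hgw
  rw [mem_ball_iff_norm, ← hxg] at hgz
  rw [mem_closedBall_zero_iff]
  calc ‖expansion B D l - z‖ = ‖(x + expansion B D l - z) - x‖ := by congr 1; abel
    _ ≤ ‖x + expansion B D l - z‖ + ‖x‖ := norm_sub_le _ _
    _ ≤ R + 1 := by linarith [hR x hx]

theorem IsExpanding.openSetCondition_of_volume_pos {n : ℕ} {B : Matrix (Fin n) (Fin n) ℝ}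
    (hB : IsExpanding B) {D : Finset (E n)} (h0 : (0 : E n) ∈ D)
    (hcard : (D.card : ℝ) = |B.det|) {K : Set (E n)} (hK : IsSelfAffineSet B D K)
    (hpos : 0 < volume K) : OpenSetCondition B D := by
  have himage : ∀ d : E n, ifsMap B d '' interior K =
      (fun x => act B x - d) ⁻¹' interior K := by
    intro d
    ext x
    constructor
    · rintro ⟨y, hy, rfl⟩
      simpa [ifsMap, hB.act_inv] using hy
    · intro hx
      exact ⟨_, hx, by simp [ifsMap, hB.inv_act]⟩
  refine ⟨interior K, isOpen_interior, hB.interior_nonempty h0 hcard hK hpos,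
    hK.2.1.isBounded.subset interior_subset, ?_, fun d hd d' hd' hdd => ?_⟩
  · refine interior_maximal (Set.iUnion₂_subset fun d hd => ?_)
      (isOpen_biUnion fun d _ => ?_)
    · refine (Set.image_mono interior_subset).trans ?_
      conv_rhs => rw [hK.2.2]
      exact Set.subset_biUnion_of_mem (u := fun d => ifsMap B d '' K) hd
    · rw [himage]
      exact isOpen_interior.preimage ((act B).continuous.sub continuous_const)
  · refine Set.disjoint_left.2 fun x hx hx' => ?_
    rw [himage] at hx hx'
    -- Digits are words of length one, so (K + d) ∩ (K + d') is null; but a common point of the two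
    -- images, moved by B, would give it a non-empty open subset.
    have hne : (fun _ : Fin 1 => (⟨d, hd⟩ : D)) ≠ fun _ => ⟨d', hd'⟩ := fun h =>
      hdd (congrArg Subtype.val (congrFun h 0))
    have hvol := hB.volume_translate_inter_eq_zero hcard hK hne
    have hexp : ∀ e : D, expansion B D (fun _ : Fin 1 => e) = e := fun e => by
      simp [expansion, act_one_apply]
    rw [hexp, hexp] at hvol
    have hopen : ∀ e : E n, IsOpen ((fun x => x - e) ⁻¹' interior K) := fun e =>
      isOpen_interior.preimage (continuous_id.sub continuous_const)
    have hpos' := ((hopen d).inter (hopen d')).measure_pos volume ⟨act B x, hx, hx'⟩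
    refine (hpos'.trans_le (measure_mono ?_)).ne' hvol
    exact fun y hy => ⟨⟨y - d, interior_subset hy.1, sub_add_cancel _ _⟩,
      ⟨y - d', interior_subset hy.2, sub_add_cancel _ _⟩⟩

end SelfAffine

theorem mainTheorem2 (n : ℕ) (B : Matrix (Fin n) (Fin n) ℝ) (hB : SelfAffine.IsExpanding B)
    (D : Finset (SelfAffine.E n)) (h0 : (0 : SelfAffine.E n) ∈ D)
    (hcard : (D.card : ℝ) = |B.det|) :
    List.TFAE [
      SelfAffine.OpenSetCondition B D,
      (∀ k : ℕ, 1 ≤ k → SelfAffine.DistinctExpansions B D k) ∧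
        SelfAffine.UniformlyDiscrete (SelfAffine.digitSetInfty B D),
      0 < MeasureTheory.volume (SelfAffine.selfAffineSet B D),
      0 < SelfAffine.upperBeurlingDensity (SelfAffine.digitMeasure B D) ∧
        SelfAffine.upperBeurlingDensity (SelfAffine.digitMeasure B D) < ⊤,
      SelfAffine.TranslationBounded (SelfAffine.digitMeasure B D)] := by
  have hK := SelfAffine.isSelfAffineSet_selfAffineSet hB ⟨0, h0⟩
  rw [SelfAffine.distinctExpansions_and_uniformlyDiscrete_iff B h0]
  tfae_have 1 → 2 := hB.separatedExpansions_of_openSetCondition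
  tfae_have 2 → 3 := fun ⟨_, hδ, hs⟩ => hB.volume_pos_of_separatedExpansions hcard hK hδ hs
  tfae_have 3 → 1 := hB.openSetCondition_of_volume_pos h0 hcard hK
  tfae_have 2 → 5 := fun ⟨_, hδ, hs⟩ => hs.translationBounded h0 hδ
  tfae_have 5 → 2 := fun h => h.exists_separatedExpansions
  tfae_have 5 → 4 := fun h =>
    ⟨hB.upperBeurlingDensity_pos h0 hcard, h.upperBeurlingDensity_lt_top h0⟩
  tfae_have 4 → 5 := fun h =>
    SelfAffine.translationBounded_of_upperBeurlingDensity_lt_top h.2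
  tfae_finish
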